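/- **Conventions.** Let $B\subset\mathbb R^3$ be the closed unit ball, with horizontal axis $x$, vertical axis $y$, and $z$ pointing towards the viewer. Put $a=\sqrt2/2$ and number the corners of a square on $\partial B$ counterclockwise: $1=(-a,-a,0)$, $2=(a,-a,0)$, $3=(a,a,0)$, $4=(-a,a,0)$. Subsets $\sigma,\tau$ of $B$ are *isotopic* if an ambient isotopy of $B$, starting at the identity and fixing $\partial B$ pointwise at all times, carries $\sigma$ onto $\tau$. The *untangle* $\tau_0$ is the union of the two vertical segments joining $4$ to $1$ and $3$ to $2$. There are two moves. * *Twist*: $T\cdot\tau$ is the union of $\tfrac12\tau$ and of the four strands ($\tfrac12\le s\le1$, $\varphi_s=\pi(2s-1)$) $$s(-a\cos\varphi_s,-a,a\sin\varphi_s),\quad s(a\cos\varphi_s,-a,-a\sin\varphi_s),\quad s(a,a,0),\quad s(-a,a,0);$$ that is, outside the concentric ball of radius $\tfrac12$ the ends at $1$ and $2$ are exchanged, $1$ passing over (in front) and $2$ under, while the ends at $3$ and $4$ go straight outwards. * *Turn*: $R\cdot\tau$ is the image of $\tau$ under the counterclockwise quarter turn $(x,y,z)\mapsto(-y,x,z)$.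 A *rational tangle* is a subset of $B$ obtained from $\tau_0$ by finitely many moves $T$ and $R$, where at any stage a tangle may be replaced by an isotopic one. **Lemma.** Every rational tangle $\tau$ has *bdpq* (Klein four-group) symmetry: its images under the rotations by $\pi$ about the horizontal and the vertical axis, $(x,y,z)\mapsto(x,-y,-z)$ and $(x,y,z)\mapsto(-x,y,-z)$, are both isotopic to $\tau$. -/

import Mathlib

namespace Tangle

/-- Euclidean three-space. Coordinate `0` is horizontal (to the right), coordinate `1` is vertical
(upwards), and coordinate `2` points towards the viewer. -/
abbrev E3 : Type := EuclideanSpace ℝ (Fin 3)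

/-- Ambient isotopy of subsets of the closed unit ball, relative to its boundary sphere: there is a
jointly continuous one-parameter family `H t` of homeomorphisms of space, starting at the identity,
each of which fixes every point that is not in the open unit ball, and `H 1` carries `σ` onto `τ`.
(Restricting to the closed ball, and extending by the identity, identifies such families with
the ambient isotopies of the closed ball that fix its boundary sphere pointwise.) -/
def Isotopic (σ τ : Set E3) : Prop :=
  ∃ H : unitInterval → (E3 ≃ₜ E3),
    Continuous (fun q : unitInterval × E3 => H q.1 q.2) ∧
    (∀ x, H 0 x = x) ∧
    (∀ t x, 1 ≤ ‖x‖ → H t x = x) ∧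
    H 1 '' σ = τ

/-- The four rope ends are at the corners `(±a, ±a, 0)` of a square inscribed in the unit circle of
the plane of projection, with `a = √2 / 2`. Position 1 is the lower left corner, and the positions
1, 2, 3, 4 follow each other counterclockwise. -/
noncomputable def a : ℝ := Real.sqrt 2 / 2

/-- Rotation by `π` about the horizontal axis (it turns `b` into `p`). -/
noncomputable def rotHorizontal (p : E3) : E3 := !₂[p 0, -p 1, -p 2]

/-- Rotation by `π` about the vertical axis (it turns `b` into `d`). -/
noncomputable def rotVertical (p : E3) : E3 := !₂[-p 0, p 1, -p 2]

/-- Rotation by `π / 2` about the line of sight, counterclockwise as seen by the viewer. -/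
noncomputable def quarterTurn (p : E3) : E3 := !₂[-p 1, p 0, p 2]

/-- The untangle: two parallel straight vertical ropes, joining the positions 4 and 1 and the
positions 3 and 2. -/
def untangle : Set E3 :=
  {p | ∃ y ∈ Set.Icc (-a) a, p = !₂[-a, y, 0] ∨ p = !₂[a, y, 0]}

/-- The rope end starting at position 1 (lower left) of the concentric ball of radius `1 / 2`
passes in front of the other one, and arrives at position 2 (lower right) of the unit ball. -/
def overStrand : Set E3 :=
  {p | ∃ s ∈ Set.Icc (1 / 2 : ℝ) 1, p =
    s • !₂[-(a * Real.cos (Real.pi * (2 * s - 1))), -a, a * Real.sin (Real.pi * (2 * s - 1))]}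

/-- The rope end starting at position 2 (lower right) of the concentric ball of radius `1 / 2`
passes behind the other one, and arrives at position 1 (lower left) of the unit ball. -/
def underStrand : Set E3 :=
  {p | ∃ s ∈ Set.Icc (1 / 2 : ℝ) 1, p =
    s • !₂[a * Real.cos (Real.pi * (2 * s - 1)), -a, -(a * Real.sin (Real.pi * (2 * s - 1)))]}

/-- The rope ends at the positions 3 and 4 (upper right and upper left) go straight outwards. -/
def straightStrands : Set E3 :=
  {p | ∃ s ∈ Set.Icc (1 / 2 : ℝ) 1, p = s • !₂[a, a, 0] ∨ p = s • !₂[-a, a, 0]}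

/-- The Twist: the given tangle is kept, scaled down to the ball of radius `1 / 2`, and outside that
ball the ends at the positions 1 and 2 are exchanged, 1 passing over and 2 passing under. -/
def twist (τ : Set E3) : Set E3 :=
  (fun p : E3 => (1 / 2 : ℝ) • p) '' τ ∪ overStrand ∪ underStrand ∪ straightStrands

/-- The tuRn: everything is rotated by a quarter turn counterclockwise. -/
def turn (τ : Set E3) : Set E3 := quarterTurn '' τ

/-- The rational tangles: the configurations of ropes (up to isotopy) that are obtained from the
untangle by finitely many moves, each a Twist or a tuRn. -/
inductive IsRational : Set E3 → Prop
  | untangle : IsRational untangle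
  | twist {τ : Set E3} (h : IsRational τ) : IsRational (twist τ)
  | turn {τ : Set E3} (h : IsRational τ) : IsRational (turn τ)
  | isotopy {σ τ : Set E3} (h : IsRational σ) (i : Isotopic σ τ) : IsRational τ

/-- Symmetry of type `bdpq`: invariance, up to isotopy, under the rotations by `π` about the
horizontal and the vertical axis. -/
def HasBdpqSymmetry (τ : Set E3) : Prop :=
  Isotopic (rotHorizontal '' τ) τ ∧ Isotopic (rotVertical '' τ) τ

end Tangle

/-!
Each rotation by `π` is carried through the moves by induction on the construction of a rational
tangle.

A quarter turn conjugates the two rotations into each other, so `turn` is harmless. The rotation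
about the vertical axis exchanges the two crossing strands of a twist and the two straight ones, so
it commutes with `twist` on the nose (`rotVertical_image_twist`).

The rotation about the horizontal axis moves the crossing of `twist τ` from the bottom to the top,
and a *flype* brings it back: the inner ball of radius `1 / 2` is rotated by `π` about the vertical
axis, and the sphere of radius `s ∈ [1 / 2, 1]` by `π * (2 - 2 * s)`. With the coordinates `x` and
`z` read as the complex number `x + i z`, the strands that cross at the top are
`± s * a * exp (i φ)`, where `φ = π * (2 * s - 1)`, and multiplication by
`exp (i (π - φ))` straightens them exactly, while it makes the straight strands at the bottom into
those of the twist. As the tangle lies in the unit ball, its inner copy is just rotated about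
the vertical axis, and so (`isotopic_twist_rotVertical_rotHorizontal`)
`rotHorizontal '' twist τ` is isotopic to `twist (rotVertical '' (rotHorizontal '' τ))`.
By the symmetry of `τ` the latter is isotopic to `twist τ`.
-/

namespace Tangle

open Real

/-! ### Isotopy -/

theorem Isotopic.trans {ρ σ τ : Set E3} (h : Isotopic ρ σ) (k : Isotopic σ τ) :
    Isotopic ρ τ := by
  obtain ⟨H, hc, h0, hf, rfl⟩ := h
  obtain ⟨K, kc, k0, kf, rfl⟩ := k
  refine ⟨fun t => (H t).trans (K t), ?_, ?_, ?_, ?_⟩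
  · exact kc.comp (continuous_fst.prodMk hc)
  · intro x
    simp [h0, k0]
  · intro t x hx
    simp [hf t x hx, kf t x hx]
  · rw [Set.image_image]
    rfl

theorem Isotopic.symm {σ τ : Set E3} (h : Isotopic σ τ) : Isotopic τ σ := by
  obtain ⟨H, hc, h0, hf, rfl⟩ := h
  -- Running the family backwards after `(H 1)⁻¹` needs no joint continuity of the inverses.
  refine ⟨fun t => (H 1).symm.trans (H (unitInterval.symm t)), ?_, ?_, ?_, ?_⟩
  · exact hc.comp ((unitInterval.continuous_symm.comp continuous_fst).prodMk
      ((H 1).symm.continuous.comp continuous_snd))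
  · intro x
    simp
  · intro t x hx
    have hx' : (H 1).symm x = x := (H 1).symm_apply_eq.2 (hf 1 x hx).symm
    simp [hx', hf _ x hx]
  · simp [Set.image_image, h0]

theorem Isotopic.of_eq {σ τ : Set E3} (h : σ = τ) : Isotopic σ τ :=
  ⟨fun _ => Homeomorph.refl E3, continuous_snd, fun _ => rfl, fun _ _ _ => rfl, by simpa using h⟩

/-- Isotopies can be transported by a homeomorphism `e` that does not leave the unit ball, and they
do not move anything outside the image of the unit ball. -/
theorem Isotopic.image_union {σ τ : Set E3} (h : Isotopic σ τ) (e : E3 ≃ₜ E3)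
    (he : ∀ x, 1 ≤ ‖x‖ → 1 ≤ ‖e.symm x‖) {A : Set E3} (hA : ∀ x ∈ A, 1 ≤ ‖e.symm x‖) :
    Isotopic (e '' σ ∪ A) (e '' τ ∪ A) := by
  obtain ⟨H, hc, h0, hf, rfl⟩ := h
  refine ⟨fun t => (e.symm.trans (H t)).trans e, ?_, ?_, ?_, ?_⟩
  · exact e.continuous.comp (hc.comp (continuous_fst.prodMk
      (e.symm.continuous.comp continuous_snd)))
  · intro x
    simp [h0]
  · intro t x hx
    simp [hf t _ (he x hx)]
  · rw [Set.image_union]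
    congr 1
    · simp [Set.image_image]
    · refine (Set.image_congr fun x hx => ?_).trans (Set.image_id' A)
      simp [hf 1 _ (hA x hx)]

theorem Isotopic.image {σ τ : Set E3} (h : Isotopic σ τ) (e : E3 ≃ₜ E3)
    (he : ∀ x, ‖e x‖ = ‖x‖) : Isotopic (e '' σ) (e '' τ) := by
  have he' : ∀ x, 1 ≤ ‖x‖ → 1 ≤ ‖e.symm x‖ := fun x hx => by
    rwa [← he, e.apply_symm_apply]
  simpa using h.image_union e he' (A := ∅) (by simp)

theorem Isotopic.subset_closedBall {σ τ : Set E3} (h : Isotopic σ τ)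
    (hσ : ∀ p ∈ σ, ‖p‖ ≤ 1) : ∀ p ∈ τ, ‖p‖ ≤ 1 := by
  obtain ⟨H, -, -, hf, rfl⟩ := h
  rintro _ ⟨p, hp, rfl⟩
  by_contra! hlt
  -- A point that is fixed by `H 1` has no other preimage than itself.
  have hfix : H 1 p = p := (H 1).injective (hf 1 _ hlt.le)
  rw [hfix] at hlt
  exact hlt.not_ge (hσ p hp)

/-! ### Rotations -/

theorem norm_sq_eq (p : E3) : ‖p‖ ^ 2 = p 0 ^ 2 + p 1 ^ 2 + p 2 ^ 2 := by
  simp [EuclideanSpace.norm_sq_eq, Fin.sum_univ_three]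

theorem norm_eq_of_sq_eq {p q : E3}
    (h : p 0 ^ 2 + p 1 ^ 2 + p 2 ^ 2 = q 0 ^ 2 + q 1 ^ 2 + q 2 ^ 2) : ‖p‖ = ‖q‖ := by
  rw [← norm_sq_eq, ← norm_sq_eq] at h
  exact (pow_left_inj₀ (norm_nonneg p) (norm_nonneg q) two_ne_zero).1 h

theorem E3.ext {p q : E3} (h0 : p 0 = q 0) (h1 : p 1 = q 1) (h2 : p 2 = q 2) : p = q := by
  ext i
  fin_cases i
  exacts [h0, h1, h2]

theorem continuous_vec {X : Type*} [TopologicalSpace X] {f g h : X → ℝ} (hf : Continuous f)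
    (hg : Continuous g) (hh : Continuous h) : Continuous fun x => (!₂[f x, g x, h x] : E3) := by
  refine (PiLp.continuous_toLp 2 _).comp (continuous_pi fun i => ?_)
  fin_cases i
  exacts [hf, hg, hh]

theorem continuous_coord (i : Fin 3) : Continuous fun p : E3 => p i := by fun_prop

/-- `rotHorizontal` as a homeomorphism. -/
noncomputable def rotHorizontalHomeo : E3 ≃ₜ E3 where
  toFun := rotHorizontal
  invFun := rotHorizontal
  left_inv p := by apply E3.ext <;> simp [rotHorizontal]
  right_inv p := by apply E3.ext <;> simp [rotHorizontal]
  continuous_toFun := continuous_vec (continuous_coord 0) (continuous_coord 1).neg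
    (continuous_coord 2).neg
  continuous_invFun := continuous_vec (continuous_coord 0) (continuous_coord 1).neg
    (continuous_coord 2).neg

/-- `rotVertical` as a homeomorphism. -/
noncomputable def rotVerticalHomeo : E3 ≃ₜ E3 where
  toFun := rotVertical
  invFun := rotVertical
  left_inv p := by apply E3.ext <;> simp [rotVertical]
  right_inv p := by apply E3.ext <;> simp [rotVertical]
  continuous_toFun := continuous_vec (continuous_coord 0).neg (continuous_coord 1)
    (continuous_coord 2).neg
  continuous_invFun := continuous_vec (continuous_coord 0).neg (continuous_coord 1)
    (continuous_coord 2).neg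

/-- `quarterTurn` as a homeomorphism. -/
noncomputable def quarterTurnHomeo : E3 ≃ₜ E3 where
  toFun := quarterTurn
  invFun p := !₂[p 1, -p 0, p 2]
  left_inv p := by apply E3.ext <;> simp [quarterTurn]
  right_inv p := by apply E3.ext <;> simp [quarterTurn]
  continuous_toFun := continuous_vec (continuous_coord 1).neg (continuous_coord 0)
    (continuous_coord 2)
  continuous_invFun := continuous_vec (continuous_coord 1) (continuous_coord 0).neg
    (continuous_coord 2)

theorem norm_rotHorizontal (p : E3) : ‖rotHorizontal p‖ = ‖p‖ :=
  norm_eq_of_sq_eq (by simp [rotHorizontal])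

theorem norm_rotVertical (p : E3) : ‖rotVertical p‖ = ‖p‖ :=
  norm_eq_of_sq_eq (by simp [rotVertical])

theorem norm_quarterTurn (p : E3) : ‖quarterTurn p‖ = ‖p‖ :=
  norm_eq_of_sq_eq (by simp [quarterTurn, add_comm])

theorem Isotopic.rotHorizontal {σ τ : Set E3} (h : Isotopic σ τ) :
    Isotopic (rotHorizontal '' σ) (rotHorizontal '' τ) :=
  h.image rotHorizontalHomeo norm_rotHorizontal

theorem Isotopic.rotVertical {σ τ : Set E3} (h : Isotopic σ τ) :
    Isotopic (rotVertical '' σ) (rotVertical '' τ) :=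
  h.image rotVerticalHomeo norm_rotVertical

theorem Isotopic.turn {σ τ : Set E3} (h : Isotopic σ τ) : Isotopic (turn σ) (turn τ) :=
  h.image quarterTurnHomeo norm_quarterTurn

theorem rotHorizontal_image_turn (τ : Set E3) :
    rotHorizontal '' turn τ = turn (rotVertical '' τ) := by
  simp only [turn, Set.image_image]
  refine Set.image_congr fun p _ => ?_
  apply E3.ext <;> simp [rotHorizontal, rotVertical, quarterTurn]

theorem rotVertical_image_turn (τ : Set E3) :
    rotVertical '' turn τ = turn (rotHorizontal '' τ) := by
  simp only [turn, Set.image_image]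
  refine Set.image_congr fun p _ => ?_
  apply E3.ext <;> simp [rotHorizontal, rotVertical, quarterTurn]

/-- Rotation by the angle `θ` about the vertical axis, from the first coordinate towards the
third one. -/
noncomputable def verticalRotation (θ : ℝ) (p : E3) : E3 :=
  !₂[cos θ * p 0 - sin θ * p 2, p 1, sin θ * p 0 + cos θ * p 2]

theorem norm_verticalRotation (θ : ℝ) (p : E3) : ‖verticalRotation θ p‖ = ‖p‖ := by
  refine norm_eq_of_sq_eq ?_
  simp only [verticalRotation, PiLp.toLp_apply, Matrix.cons_val]
  linear_combination (p 0 ^ 2 + p 2 ^ 2) * sin_sq_add_cos_sq θ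

theorem verticalRotation_zero (p : E3) : verticalRotation 0 p = p := by
  apply E3.ext <;> simp [verticalRotation]

theorem verticalRotation_pi (p : E3) : verticalRotation π p = rotVertical p := by
  apply E3.ext <;> simp [verticalRotation, rotVertical]

theorem verticalRotation_add (α β : ℝ) (p : E3) :
    verticalRotation α (verticalRotation β p) = verticalRotation (α + β) p := by
  apply E3.ext <;>
  · simp only [verticalRotation, PiLp.toLp_apply, Matrix.cons_val, cos_add, sin_add]
    try ring

theorem continuous_verticalRotation {X : Type*} [TopologicalSpace X] {θ : X → ℝ} {p : X → E3}
    (hθ : Continuous θ) (hp : Continuous p) :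
    Continuous fun x => verticalRotation (θ x) (p x) := by
  have h (i : Fin 3) : Continuous fun x => p x i := (continuous_coord i).comp hp
  have hc := continuous_cos.comp hθ
  have hs := continuous_sin.comp hθ
  exact continuous_vec ((hc.mul (h 0)).sub (hs.mul (h 2))) (h 1)
    ((hs.mul (h 0)).add (hc.mul (h 2)))

/-- The homeomorphism that rotates each sphere about the origin as a whole about the vertical axis,
the one of radius `r` by the angle `θ r`. -/
noncomputable def spin (θ : ℝ → ℝ) (hθ : Continuous θ) : E3 ≃ₜ E3 where
  toFun p := verticalRotation (θ ‖p‖) p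
  invFun p := verticalRotation (-θ ‖p‖) p
  left_inv p := by
    simp [norm_verticalRotation, verticalRotation_add, verticalRotation_zero]
  right_inv p := by
    simp [norm_verticalRotation, verticalRotation_add, verticalRotation_zero]
  continuous_toFun := continuous_verticalRotation (hθ.comp continuous_norm) continuous_id
  continuous_invFun := continuous_verticalRotation (hθ.comp continuous_norm).neg continuous_id

/-! ### The twist -/

theorem a_sq : a ^ 2 = 1 / 2 := by
  rw [a, div_pow, sq_sqrt (by norm_num)]
  norm_num

theorem norm_smul_corner {s x y z : ℝ} (hs : 0 ≤ s) (h : x ^ 2 + y ^ 2 + z ^ 2 = 1) :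
    ‖(s • !₂[x, y, z] : E3)‖ = s := by
  have h1 : ‖(!₂[x, y, z] : E3)‖ = 1 := by
    rw [← pow_left_inj₀ (norm_nonneg _) zero_le_one two_ne_zero, norm_sq_eq]
    simpa using h
  rw [norm_smul, h1, mul_one, norm_of_nonneg hs]

/-- The three coordinates of an over- or understrand, before scaling, form a unit vector. -/
theorem sq_sum_strand (φ : ℝ) : (a * cos φ) ^ 2 + a ^ 2 + (a * sin φ) ^ 2 = 1 := by
  linear_combination a ^ 2 * sin_sq_add_cos_sq φ + 2 * a_sq

/-- The part of a twisted tangle outside the inner ball. -/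
def twistStrands : Set E3 := overStrand ∪ underStrand ∪ straightStrands

theorem twist_eq (τ : Set E3) :
    twist τ = (fun p : E3 => (1 / 2 : ℝ) • p) '' τ ∪ twistStrands := by
  simp only [twist, twistStrands, Set.union_assoc]

theorem norm_overStrand {s : ℝ} (hs : s ∈ Set.Icc (1 / 2 : ℝ) 1) (φ : ℝ) :
    ‖(s • !₂[-(a * cos φ), -a, a * sin φ] : E3)‖ = s :=
  norm_smul_corner (by linarith [hs.1]) (by simpa using sq_sum_strand φ)

theorem norm_underStrand {s : ℝ} (hs : s ∈ Set.Icc (1 / 2 : ℝ) 1) (φ : ℝ) :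
    ‖(s • !₂[a * cos φ, -a, -(a * sin φ)] : E3)‖ = s :=
  norm_smul_corner (by linarith [hs.1]) (by simpa using sq_sum_strand φ)

theorem norm_straightRight {s : ℝ} (hs : s ∈ Set.Icc (1 / 2 : ℝ) 1) :
    ‖(s • !₂[a, a, 0] : E3)‖ = s :=
  norm_smul_corner (by linarith [hs.1]) (by linear_combination 2 * a_sq)

theorem norm_straightLeft {s : ℝ} (hs : s ∈ Set.Icc (1 / 2 : ℝ) 1) :
    ‖(s • !₂[-a, a, 0] : E3)‖ = s :=
  norm_smul_corner (by linarith [hs.1]) (by linear_combination 2 * a_sq)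

theorem norm_mem_of_mem_twistStrands {p : E3} (hp : p ∈ twistStrands) :
    ‖p‖ ∈ Set.Icc (1 / 2 : ℝ) 1 := by
  rcases hp with (⟨s, hs, rfl⟩ | ⟨s, hs, rfl⟩) | ⟨s, hs, rfl | rfl⟩
  · rwa [norm_overStrand hs]
  · rwa [norm_underStrand hs]
  · rwa [norm_straightRight hs]
  · rwa [norm_straightLeft hs]

theorem Isotopic.twist {σ τ : Set E3} (h : Isotopic σ τ) : Isotopic (twist σ) (twist τ) := by
  have hn (x : E3) : ‖(Homeomorph.smulOfNeZero (1 / 2 : ℝ) (by norm_num)).symm x‖ = 2 * ‖x‖ := by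
    change ‖(1 / 2 : ℝ)⁻¹ • x‖ = 2 * ‖x‖
    rw [norm_smul]
    norm_num
  rw [twist_eq, twist_eq]
  refine h.image_union (Homeomorph.smulOfNeZero (1 / 2 : ℝ) (by norm_num)) ?_ ?_
  · intro x hx
    rw [hn]
    linarith
  · intro x hx
    rw [hn]
    linarith [(norm_mem_of_mem_twistStrands hx).1]

theorem norm_le_one_of_isRational {τ : Set E3} (h : IsRational τ) : ∀ p ∈ τ, ‖p‖ ≤ 1 := by
  induction h with
  | untangle =>
    rintro _ ⟨y, hy, rfl | rfl⟩ <;>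
    · rw [← sq_le_one_iff₀ (norm_nonneg _), norm_sq_eq]
      have hy2 : y ^ 2 ≤ a ^ 2 := sq_le_sq' hy.1 hy.2
      simp only [Matrix.cons_val]
      linarith [a_sq, neg_sq a]
  | @twist τ _ ih =>
    intro p hp
    rw [twist_eq] at hp
    rcases hp with ⟨q, hq, rfl⟩ | hp
    · have := ih q hq
      simp only [norm_smul]
      norm_num
      linarith
    · exact (norm_mem_of_mem_twistStrands hp).2
  | turn _ ih =>
    rintro _ ⟨p, hp, rfl⟩
    rw [norm_quarterTurn]
    exact ih p hp
  | isotopy _ i ih => exact i.subset_closedBall ih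

theorem rotVertical_image_twistStrands : rotVertical '' twistStrands = twistStrands := by
  have hsub : rotVertical '' twistStrands ⊆ twistStrands := by
    rintro _ ⟨_, (⟨s, hs, rfl⟩ | ⟨s, hs, rfl⟩) | ⟨s, hs, rfl | rfl⟩, rfl⟩
    · refine Or.inl (Or.inr ⟨s, hs, ?_⟩)
      apply E3.ext <;> simp [rotVertical]
    · refine Or.inl (Or.inl ⟨s, hs, ?_⟩)
      apply E3.ext <;> simp [rotVertical]
    · refine Or.inr ⟨s, hs, Or.inr ?_⟩
      apply E3.ext <;> simp [rotVertical]
    · refine Or.inr ⟨s, hs, Or.inl ?_⟩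
      apply E3.ext <;> simp [rotVertical]
  -- `rotVertical` is an involution, so that one inclusion gives the other.
  refine hsub.antisymm fun p hp => ⟨rotVertical p, hsub ⟨p, hp, rfl⟩, ?_⟩
  exact rotVerticalHomeo.left_inv p

theorem rotVertical_image_twist (τ : Set E3) :
    rotVertical '' twist τ = twist (rotVertical '' τ) := by
  rw [twist_eq, twist_eq, Set.image_union, rotVertical_image_twistStrands]
  simp only [Set.image_image]
  refine congrArg (· ∪ twistStrands) (Set.image_congr fun p _ => ?_)
  apply E3.ext <;> simp [rotVertical]

/-! ### The flype -/

/-- The angle by which the flype rotates the sphere of radius `r`: it is `π` for `r ≤ 1 / 2`, and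
decreases linearly to `0` at `r = 1`. -/
noncomputable def flypeAngle (r : ℝ) : ℝ := π * max 0 (min 1 (2 - 2 * r))

theorem continuous_flypeAngle : Continuous flypeAngle := by
  unfold flypeAngle
  fun_prop

theorem flypeAngle_of_one_le {r : ℝ} (h : 1 ≤ r) : flypeAngle r = 0 := by
  rw [flypeAngle, max_eq_left ((min_le_right _ _).trans (by linarith)), mul_zero]

theorem flypeAngle_of_le_half {r : ℝ} (h : r ≤ 1 / 2) : flypeAngle r = π := by
  rw [flypeAngle, min_eq_left (by linarith), max_eq_right zero_le_one, mul_one]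

theorem flypeAngle_of_mem {r : ℝ} (h : r ∈ Set.Icc (1 / 2 : ℝ) 1) :
    flypeAngle r = π - π * (2 * r - 1) := by
  rw [flypeAngle, min_eq_right (by linarith [h.1]), max_eq_right (by linarith [h.2])]
  ring

/-- The end of the flype, on the whole of space. -/
noncomputable def flype (p : E3) : E3 := verticalRotation (flypeAngle ‖p‖) p

theorem isotopic_flype (σ : Set E3) : Isotopic σ (flype '' σ) := by
  refine ⟨fun t => spin (fun r => t * flypeAngle r) (continuous_const.mul continuous_flypeAngle),
    ?_, ?_, ?_, ?_⟩
  · exact continuous_verticalRotation ((continuous_subtype_val.comp continuous_fst).mul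
      (continuous_flypeAngle.comp (continuous_norm.comp continuous_snd))) continuous_snd
  · intro x
    simp [spin, verticalRotation_zero]
  · intro t x hx
    simp [spin, flypeAngle_of_one_le hx, verticalRotation_zero]
  · refine Set.image_congr fun p _ => ?_
    simp [spin, flype]

/-- On the sphere of radius `s ∈ [1 / 2, 1]` the flype multiplies the complex number `x + i z`
by `- exp (- i φ)`, where `φ = π * (2 * s - 1)`. -/
theorem flype_of_norm_eq {p : E3} {s : ℝ} (hs : s ∈ Set.Icc (1 / 2 : ℝ) 1) (hp : ‖p‖ = s) :
    flype p = !₂[-cos (π * (2 * s - 1)) * p 0 - sin (π * (2 * s - 1)) * p 2, p 1,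
      sin (π * (2 * s - 1)) * p 0 - cos (π * (2 * s - 1)) * p 2] := by
  rw [flype, hp, flypeAngle_of_mem hs, verticalRotation, cos_pi_sub, sin_pi_sub]
  apply E3.ext <;> simp [sub_eq_add_neg]

theorem flype_rotHorizontal_overStrand {s : ℝ} (hs : s ∈ Set.Icc (1 / 2 : ℝ) 1) :
    flype (rotHorizontal
      (s • !₂[-(a * cos (π * (2 * s - 1))), -a, a * sin (π * (2 * s - 1))])) =
      s • !₂[a, a, 0] := by
  rw [flype_of_norm_eq hs (by rw [norm_rotHorizontal, norm_overStrand hs])]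
  generalize π * (2 * s - 1) = φ
  apply E3.ext <;> simp only [rotHorizontal, PiLp.toLp_apply, PiLp.smul_apply, Matrix.cons_val,
    smul_eq_mul]
  · linear_combination s * a * sin_sq_add_cos_sq φ
  · ring
  · ring

theorem flype_rotHorizontal_underStrand {s : ℝ} (hs : s ∈ Set.Icc (1 / 2 : ℝ) 1) :
    flype (rotHorizontal
      (s • !₂[a * cos (π * (2 * s - 1)), -a, -(a * sin (π * (2 * s - 1)))])) =
      s • !₂[-a, a, 0] := by
  rw [flype_of_norm_eq hs (by rw [norm_rotHorizontal, norm_underStrand hs])]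
  generalize π * (2 * s - 1) = φ
  apply E3.ext <;> simp only [rotHorizontal, PiLp.toLp_apply, PiLp.smul_apply, Matrix.cons_val,
    smul_eq_mul]
  · linear_combination -(s * a) * sin_sq_add_cos_sq φ
  · ring
  · ring

theorem flype_rotHorizontal_straightRight {s : ℝ} (hs : s ∈ Set.Icc (1 / 2 : ℝ) 1) :
    flype (rotHorizontal (s • !₂[a, a, 0])) =
      s • !₂[-(a * cos (π * (2 * s - 1))), -a, a * sin (π * (2 * s - 1))] := by
  rw [flype_of_norm_eq hs (by rw [norm_rotHorizontal, norm_straightRight hs])]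
  apply E3.ext <;> simp only [rotHorizontal, PiLp.toLp_apply, PiLp.smul_apply, Matrix.cons_val,
    smul_eq_mul] <;> ring

theorem flype_rotHorizontal_straightLeft {s : ℝ} (hs : s ∈ Set.Icc (1 / 2 : ℝ) 1) :
    flype (rotHorizontal (s • !₂[-a, a, 0])) =
      s • !₂[a * cos (π * (2 * s - 1)), -a, -(a * sin (π * (2 * s - 1)))] := by
  rw [flype_of_norm_eq hs (by rw [norm_rotHorizontal, norm_straightLeft hs])]
  apply E3.ext <;> simp only [rotHorizontal, PiLp.toLp_apply, PiLp.smul_apply, Matrix.cons_val,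
    smul_eq_mul] <;> ring

theorem flype_image_rotHorizontal_image_twistStrands :
    flype '' (rotHorizontal '' twistStrands) = twistStrands := by
  rw [Set.image_image]
  apply Set.Subset.antisymm
  · rintro _ ⟨_, (⟨s, hs, rfl⟩ | ⟨s, hs, rfl⟩) | ⟨s, hs, rfl | rfl⟩, rfl⟩
    · exact Or.inr ⟨s, hs, Or.inl (flype_rotHorizontal_overStrand hs)⟩
    · exact Or.inr ⟨s, hs, Or.inr (flype_rotHorizontal_underStrand hs)⟩
    · exact Or.inl (Or.inl ⟨s, hs, flype_rotHorizontal_straightRight hs⟩)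
    · exact Or.inl (Or.inr ⟨s, hs, flype_rotHorizontal_straightLeft hs⟩)
  · rintro _ ((⟨s, hs, rfl⟩ | ⟨s, hs, rfl⟩) | ⟨s, hs, rfl | rfl⟩)
    · exact ⟨_, Or.inr ⟨s, hs, Or.inl rfl⟩, flype_rotHorizontal_straightRight hs⟩
    · exact ⟨_, Or.inr ⟨s, hs, Or.inr rfl⟩, flype_rotHorizontal_straightLeft hs⟩
    · exact ⟨_, Or.inl (Or.inl ⟨s, hs, rfl⟩), flype_rotHorizontal_overStrand hs⟩
    · exact ⟨_, Or.inl (Or.inr ⟨s, hs, rfl⟩), flype_rotHorizontal_underStrand hs⟩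

theorem flype_rotHorizontal_half_smul {p : E3} (hp : ‖p‖ ≤ 1) :
    flype (rotHorizontal ((1 / 2 : ℝ) • p)) = (1 / 2 : ℝ) • rotVertical (rotHorizontal p) := by
  have hn : ‖rotHorizontal ((1 / 2 : ℝ) • p)‖ ≤ 1 / 2 := by
    rw [norm_rotHorizontal, norm_smul, norm_of_nonneg (by norm_num)]
    linarith
  rw [flype, flypeAngle_of_le_half hn, verticalRotation_pi]
  apply E3.ext <;> simp [rotHorizontal, rotVertical]

/-- The flype takes the crossing from the top back to the bottom, at the price of a rotation of the
inner tangle about the vertical axis. -/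
theorem isotopic_twist_rotVertical_rotHorizontal {τ : Set E3} (hτ : ∀ p ∈ τ, ‖p‖ ≤ 1) :
    Isotopic (rotHorizontal '' twist τ) (twist (rotVertical '' (rotHorizontal '' τ))) := by
  refine (isotopic_flype _).trans (Isotopic.of_eq ?_)
  rw [twist_eq, twist_eq, Set.image_union, Set.image_union,
    flype_image_rotHorizontal_image_twistStrands]
  simp only [Set.image_image]
  exact congrArg (· ∪ twistStrands)
    (Set.image_congr fun p hp => flype_rotHorizontal_half_smul (hτ p hp))

/-! ### The symmetry of rational tangles -/

theorem rotHorizontal_image_untangle : rotHorizontal '' untangle = untangle := by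
  have hsub : rotHorizontal '' untangle ⊆ untangle := by
    rintro _ ⟨_, ⟨y, hy, rfl | rfl⟩, rfl⟩
    · refine ⟨-y, ⟨neg_le_neg hy.2, neg_le.1 hy.1⟩, Or.inl ?_⟩
      apply E3.ext <;> simp [rotHorizontal]
    · refine ⟨-y, ⟨neg_le_neg hy.2, neg_le.1 hy.1⟩, Or.inr ?_⟩
      apply E3.ext <;> simp [rotHorizontal]
  refine hsub.antisymm fun p hp => ⟨rotHorizontal p, hsub ⟨p, hp, rfl⟩, ?_⟩
  exact rotHorizontalHomeo.left_inv p

theorem rotVertical_image_untangle : rotVertical '' untangle = untangle := by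
  have hsub : rotVertical '' untangle ⊆ untangle := by
    rintro _ ⟨_, ⟨y, hy, rfl | rfl⟩, rfl⟩
    · refine ⟨y, hy, Or.inr ?_⟩
      apply E3.ext <;> simp [rotVertical]
    · refine ⟨y, hy, Or.inl ?_⟩
      apply E3.ext <;> simp [rotVertical]
  refine hsub.antisymm fun p hp => ⟨rotVertical p, hsub ⟨p, hp, rfl⟩, ?_⟩
  exact rotVerticalHomeo.left_inv p

theorem IsRational.hasBdpqSymmetry {τ : Set E3} (hτ : IsRational τ) : HasBdpqSymmetry τ := by
  induction hτ with
  | untangle =>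
    exact ⟨.of_eq rotHorizontal_image_untangle, .of_eq rotVertical_image_untangle⟩
  | @twist τ hτ ih =>
    constructor
    · exact (isotopic_twist_rotVertical_rotHorizontal (norm_le_one_of_isRational hτ)).trans
        (ih.1.rotVertical.trans ih.2).twist
    · rw [rotVertical_image_twist]
      exact ih.2.twist
  | @turn τ _ ih =>
    constructor
    · rw [rotHorizontal_image_turn]
      exact ih.2.turn
    · rw [rotVertical_image_turn]
      exact ih.1.turn
  | isotopy _ i ih =>
    exact ⟨i.symm.rotHorizontal.trans (ih.1.trans i), i.symm.rotVertical.trans (ih.2.trans i)⟩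

end Tangle

theorem lemma3p3 (τ : Set Tangle.E3) (hτ : Tangle.IsRational τ) :
    Tangle.HasBdpqSymmetry τ := by
  exact hτ.hasBdpqSymmetry
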